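/- Call a probability measure $\mu$ on $\mathbb{R}$ regularly varying with index $\alpha$ if $\mu(\{t:|t|\ge x\})\sim L(x)x^{-\alpha}$ as $x\to\infty$ for some slowly varying function $L$, that is, $L$ is positive near infinity and $L(ax)/L(x)\to1$ as $x\to\infty$ for every $a>0$. A probability measure on $\mathbb{R}^p$ supported on the unit sphere $\mathbb{S}^{p-1}$ is called a symmetric $\alpha$-spherical distribution if it is the law of $$\Big(\frac{\xi_1}{\sqrt{\sum_{k=1}^p\xi_k^2}},\dots,\frac{\xi_p}{\sqrt{\sum_{k=1}^p\xi_k^2}}\Big),$$ where $\xi_1,\dots,\xi_p$ are i.i.d. with a common law that is symmetric and regularly varying with index $\alpha$. Let $\alpha\in(0,2)$, let $p=p_n\ge1$ be integers with $p_n\to\infty$ and $p_n/n^2\to0$ as $n\to\infty$, and for each $n$ let $\mu_{\alpha,p_n}$ be a symmetric $\alpha$-spherical distribution on $\mathbb{S}^{p_n-1}$. For points $x_1,\dots,x_n\in\mathbb{R}^{p_n}$ let $$R_n(x_1,\dots,x_n)=\frac{\sqrt{2p_n}}{n}\sum_{1\le i<j\le n}x_i^\top x_j .$$ Then: (i) if,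 for each $n$, $X_1,\dots,X_n$ are i.i.d. with law $\mu_{\alpha,p_n}$, then $R_n(X_1,\dots,X_n)$ converges in distribution to $N(0,1)$ as $n\to\infty$; (ii) if, for each $n$, $U_1,\dots,U_n$ are i.i.d. uniform on $\mathbb{S}^{p_n-1}$, then $R_n(U_1,\dots,U_n)$ also converges in distribution to $N(0,1)$; (iii) consequently the Rayleigh test is asymptotically blind to these alternatives: for every $\beta\in(0,1)$ and all real critical values $c_n$ with $\mathbb{P}(R_n(U_1,\dots,U_n)\ge c_n)\to\beta$, one has $\mathbb{P}(R_n(X_1,\dots,X_n)\ge c_n)\to\beta$. -/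

import Mathlib

open MeasureTheory ProbabilityTheory Filter Topology

noncomputable section

/-- A slowly varying function (at infinity). -/
structure IsSlowlyVarying (L : ℝ → ℝ) : Prop where
  eventually_pos : ∀ᶠ x in atTop, 0 < L x
  tendsto_ratio : ∀ a : ℝ, 0 < a → Tendsto (fun x => L (a * x) / L x) atTop (𝓝 1)

/-- The law `μ` on `ℝ` has a regularly varying tail of index `α`: there is a slowly varying `L`
with `μ {t | x ≤ |t|} ∼ L x * x ^ (-α)` as `x → ∞`. -/
def HasRegularlyVaryingTail (α : ℝ) (μ : Measure ℝ) : Prop :=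
  ∃ L : ℝ → ℝ, IsSlowlyVarying L ∧
    Asymptotics.IsEquivalent atTop (fun x : ℝ => μ.real {t | x ≤ |t|})
      (fun x : ℝ => L x * x ^ (-α))

/-- The projection `x ↦ (x k / √(∑ j, x j ^ 2))ₖ` of a vector onto the unit sphere. -/
def sphereProj {p : ℕ} (x : Fin p → ℝ) : EuclideanSpace ℝ (Fin p) :=
  WithLp.toLp 2 (fun k => x k / √(∑ j, x j ^ 2))

/-- `ν` is a symmetric `α`-spherical distribution on the unit sphere of `ℝ^p`: it is supported on
the sphere, and it is the law of the projection of a vector with i.i.d. coordinates whose common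
law is symmetric and regularly varying of index `α`. -/
structure IsSymmAlphaSpherical (α : ℝ) (p : ℕ) (ν : Measure (EuclideanSpace ℝ (Fin p))) :
    Prop where
  support_sphere : ν (Metric.sphere 0 1)ᶜ = 0
  exists_law : ∃ μ : Measure ℝ, IsProbabilityMeasure μ ∧ HasRegularlyVaryingTail α μ ∧
    μ.map (fun t => -t) = μ ∧ ν = (Measure.pi fun _ : Fin p => μ).map sphereProj

/-- The uniform distribution on the unit sphere of `ℝ^p` (`1 ≤ p`), that is, normalized surface
measure, as a measure on `ℝ^p`. -/
def uniformSphere (p : ℕ) : Measure (EuclideanSpace ℝ (Fin p)) :=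
  (cond (volume : Measure (EuclideanSpace ℝ (Fin p))).toSphere Set.univ).map Subtype.val

/-- The random vectors `X i` are i.i.d. with common law `ν` under `P`. -/
structure IsIIDSample {Ω : Type*} [MeasurableSpace Ω] (P : Measure Ω) {n p : ℕ}
    (X : Fin n → Ω → EuclideanSpace ℝ (Fin p)) (ν : Measure (EuclideanSpace ℝ (Fin p))) :
    Prop where
  hasLaw : ∀ i, HasLaw (X i) ν P
  indep : iIndepFun X P

/-- The Rayleigh statistic `(√(2 p) / n) ∑_{i < j} xᵢᵀ xⱼ` of `n` points in `ℝ^p`. -/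
def rayleigh {n p : ℕ} (x : Fin n → EuclideanSpace ℝ (Fin p)) : ℝ :=
  √(2 * p) / n * ∑ i : Fin n, ∑ j ∈ Finset.Ioi i, inner ℝ (x i) (x j)

end

/-! Both sampling laws are invariant under sign changes and permutations of the coordinates, so (i)
and (ii) are instances of one central limit theorem, `tendstoInDistribution_rayleigh`. Let S_k be
the sum of the first k observations and M_k the sum of their pairwise inner products, so that
M_{k+1} = M_k + ⟪S_k, X_{k+1}⟫. Given the past, the increment is symmetric with variance exactly
‖S_k‖²/p, and ‖S_k‖² concentrates around k. At frequency u = t√(2p)/n, one step therefore multiplies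
the characteristic function of M_k by about 1 - t²k/n² ≈ exp(-t²k/n²), and the product over k < n
tends to exp(-t²/2).

`norm_integral_exp_walkLaw_sub_le` makes this quantitative. The error is of order 1/√p (fluctuation
of ‖S_k‖²), 1/n and p/n² (fourth moments); the last covers laws concentrated near the coordinate
axes.

For (iii), the common limit has no atoms, so its quantiles trap the critical values:
`tendsto_measureReal_le_of_tendstoInDistribution`. -/

/-- Reversal of the sign of the `k`-th coordinate. -/
def flipCoord {p : ℕ} (k : Fin p) (x : EuclideanSpace ℝ (Fin p)) : EuclideanSpace ℝ (Fin p) :=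
  WithLp.toLp 2 (fun i => if i = k then -x i else x i)

/-- Permutation of the coordinates. -/
def permCoord {p : ℕ} (σ : Equiv.Perm (Fin p)) (x : EuclideanSpace ℝ (Fin p)) :
    EuclideanSpace ℝ (Fin p) :=
  WithLp.toLp 2 (fun i => x (σ i))

/-- Probability measures on the unit sphere that are invariant under sign changes and permutations
of the coordinates. -/
structure IsSignPermInvariant {p : ℕ} (ν : Measure (EuclideanSpace ℝ (Fin p))) : Prop where
  isProbabilityMeasure : IsProbabilityMeasure ν
  support_sphere : ν (Metric.sphere 0 1)ᶜ = 0
  map_flip : ∀ k, ν.map (flipCoord k) = ν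
  map_perm : ∀ σ, ν.map (permCoord σ) = ν

@[simp] lemma flipCoord_apply {p : ℕ} (k i : Fin p) (x : EuclideanSpace ℝ (Fin p)) :
    flipCoord k x i = if i = k then -x i else x i := rfl

@[simp] lemma permCoord_apply {p : ℕ} (σ : Equiv.Perm (Fin p)) (i : Fin p)
    (x : EuclideanSpace ℝ (Fin p)) : permCoord σ x i = x (σ i) := rfl

lemma continuous_flipCoord {p : ℕ} (k : Fin p) : Continuous (flipCoord k) := by
  refine (PiLp.continuous_toLp 2 _).comp (continuous_pi fun i => ?_)
  by_cases h : i = k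
  · simp only [h, if_true]; fun_prop
  · simp only [h, if_false]; fun_prop

lemma continuous_permCoord {p : ℕ} (σ : Equiv.Perm (Fin p)) : Continuous (permCoord σ) :=
  (PiLp.continuous_toLp 2 _).comp (continuous_pi fun i => by fun_prop)

/-- All laws below have compact support, so continuity settles every integrability question. -/
lemma MeasureTheory.Integrable.of_continuous_of_ae_mem_isCompact {X F : Type*} [TopologicalSpace X]
    [T2Space X] [MeasurableSpace X] [OpensMeasurableSpace X] [NormedAddCommGroup F]
    {ν : Measure X} [IsFiniteMeasure ν] {K : Set X} (hK : IsCompact K) (h : ∀ᵐ x ∂ν, x ∈ K)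
    {f : X → F} (hf : Continuous f) : Integrable f ν := by
  have h1 := hf.continuousOn.integrableOn_compact (μ := ν) hK
  rwa [IntegrableOn, Measure.restrict_eq_self_of_ae_mem h] at h1

/-! ### Moments of linear forms under one invariant law -/

namespace IsSignPermInvariant

variable {p : ℕ} {ν : Measure (EuclideanSpace ℝ (Fin p))}

lemma ae_mem_sphere (h : IsSignPermInvariant ν) :
    ∀ᵐ x ∂ν, x ∈ Metric.sphere (0 : EuclideanSpace ℝ (Fin p)) 1 :=
  h.support_sphere

lemma ae_norm (h : IsSignPermInvariant ν) : ∀ᵐ x ∂ν, ‖x‖ = 1 :=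
  h.ae_mem_sphere.mono fun x hx => by simpa using hx

lemma integrable (h : IsSignPermInvariant ν) {F : Type*} [NormedAddCommGroup F]
    {f : EuclideanSpace ℝ (Fin p) → F} (hf : Continuous f) : Integrable f ν :=
  haveI := h.isProbabilityMeasure
  .of_continuous_of_ae_mem_isCompact (isCompact_sphere 0 1) h.ae_mem_sphere hf

lemma integral_comp_flip (h : IsSignPermInvariant ν) (k : Fin p)
    {f : EuclideanSpace ℝ (Fin p) → ℝ} (hf : Continuous f) :
    ∫ x, f (flipCoord k x) ∂ν = ∫ x, f x ∂ν := by
  conv_rhs => rw [← h.map_flip k]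
  rw [integral_map (continuous_flipCoord k).aemeasurable hf.aestronglyMeasurable]

lemma integral_comp_perm (h : IsSignPermInvariant ν) (σ : Equiv.Perm (Fin p))
    {f : EuclideanSpace ℝ (Fin p) → ℝ} (hf : Continuous f) :
    ∫ x, f (permCoord σ x) ∂ν = ∫ x, f x ∂ν := by
  conv_rhs => rw [← h.map_perm σ]
  rw [integral_map (continuous_permCoord σ).aemeasurable hf.aestronglyMeasurable]

lemma integral_eq_zero_of_flip (h : IsSignPermInvariant ν) (k : Fin p)
    {f : EuclideanSpace ℝ (Fin p) → ℝ} (hf : Continuous f) (hk : ∀ x, f (flipCoord k x) = -f x) :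
    ∫ x, f x ∂ν = 0 := by
  have := h.integral_comp_flip k hf
  simp only [hk, integral_neg] at this
  linarith

lemma integral_coord_sq (h : IsSignPermInvariant ν) (k : Fin p) :
    ∫ x, x k ^ 2 ∂ν = 1 / p := by
  have := h.isProbabilityMeasure
  have h1 : ∀ l, ∫ x, x l ^ 2 ∂ν = ∫ x, x k ^ 2 ∂ν := fun l => by
    rw [← h.integral_comp_perm (Equiv.swap k l) (f := fun x => x k ^ 2) (by fun_prop)]
    simp
  have h2 : ∑ l, ∫ x, x l ^ 2 ∂ν = 1 := by
    rw [← integral_finsetSum _ fun l _ => h.integrable (by fun_prop)]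
    rw [integral_congr_ae (g := fun _ => 1)]
    · simp
    · filter_upwards [h.ae_norm] with x hx
      rw [← EuclideanSpace.real_norm_sq_eq, hx, one_pow]
  have hp : (p : ℝ) ≠ 0 := by
    rintro h0
    have : p = 0 := by exact_mod_cast h0
    subst this
    exact k.elim0
  simp only [h1, Finset.sum_const, Finset.card_univ, Fintype.card_fin, nsmul_eq_mul] at h2
  field_simp
  linarith

lemma integral_sum_coord_pow_four_le (h : IsSignPermInvariant ν) :
    ∑ k, ∫ x, x k ^ 4 ∂ν ≤ 1 := by
  have := h.isProbabilityMeasure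
  rw [← integral_finsetSum _ fun l _ => h.integrable (by fun_prop)]
  calc _ ≤ ∫ x : EuclideanSpace ℝ (Fin p), (1 : ℝ) ∂ν := by
        refine integral_mono_ae (h.integrable (by fun_prop)) (by simp) ?_
        filter_upwards [h.ae_norm] with x hx
        have h1 : ∑ i, x i ^ 2 = 1 := by rw [← EuclideanSpace.real_norm_sq_eq, hx, one_pow]
        rw [← h1]
        refine Finset.sum_le_sum fun i _ => ?_
        have : x i ^ 2 ≤ 1 := by
          rw [← h1]
          exact Finset.single_le_sum (f := fun i => x i ^ 2) (fun i _ => sq_nonneg _)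
            (Finset.mem_univ i)
        nlinarith [sq_nonneg (x i)]
    _ = 1 := by simp

/-- Equality holds for the uniform law on the points ±e_k; this bound is the origin of the p/n²
error. -/
lemma integral_coord_pow_four_le (h : IsSignPermInvariant ν) (k : Fin p) :
    ∫ x, x k ^ 4 ∂ν ≤ 1 / p := by
  rw [← h.integral_coord_sq k]
  refine integral_mono_ae (h.integrable (by fun_prop)) (h.integrable (by fun_prop)) ?_
  filter_upwards [h.ae_norm] with x hx
  have h1 : |x k| ≤ 1 := by simpa [hx] using PiLp.norm_apply_le x k
  have : x k ^ 2 ≤ 1 := (sq_le_one_iff_abs_le_one _).2 h1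
  nlinarith [sq_nonneg (x k)]

/-- The p - 1 mixed moments with k fixed are equal by exchangeability, and their sum is at most E
x_k² = 1/p. -/
lemma integral_coord_sq_mul_sq_le (h : IsSignPermInvariant ν) {k l : Fin p} (hkl : l ≠ k) :
    ∫ x, x k ^ 2 * x l ^ 2 ∂ν ≤ 1 / (p * (p - 1)) := by
  have h1 : ∀ m ∈ Finset.univ.erase k, ∫ x, x k ^ 2 * x m ^ 2 ∂ν = ∫ x, x k ^ 2 * x l ^ 2 ∂ν := by
    intro m hm
    rw [← h.integral_comp_perm (Equiv.swap l m) (f := fun x => x k ^ 2 * x l ^ 2) (by fun_prop)]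
    simp [Equiv.swap_apply_of_ne_of_ne hkl.symm (Finset.ne_of_mem_erase hm).symm]
  have h2 : ∑ m ∈ Finset.univ.erase k, ∫ x, x k ^ 2 * x m ^ 2 ∂ν ≤ 1 / p := by
    rw [← integral_finsetSum _ fun l _ => h.integrable (by fun_prop), ← h.integral_coord_sq k]
    refine integral_mono_ae (h.integrable (by fun_prop)) (h.integrable (by fun_prop)) ?_
    filter_upwards [h.ae_norm] with x hx
    have h1 : ∑ i, x i ^ 2 = 1 := by rw [← EuclideanSpace.real_norm_sq_eq, hx, one_pow]
    rw [← Finset.mul_sum]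
    have : ∑ i ∈ Finset.univ.erase k, x i ^ 2 ≤ ∑ i, x i ^ 2 :=
      Finset.sum_le_sum_of_subset_of_nonneg (Finset.erase_subset _ _) fun i _ _ => sq_nonneg _
    nlinarith [sq_nonneg (x k)]
  rw [Finset.sum_congr rfl h1, Finset.sum_const, Finset.card_erase_of_mem (Finset.mem_univ _),
    Finset.card_univ, Fintype.card_fin, nsmul_eq_mul] at h2
  have hp : 2 ≤ p := by
    have := k.2; have := l.2; have : (l : ℕ) ≠ k := fun h => hkl (Fin.ext h); omega
  have hp' : (2 : ℝ) ≤ p := by exact_mod_cast hp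
  rw [Nat.cast_sub (by omega), Nat.cast_one, le_div_iff₀ (by linarith)] at h2
  rw [le_div_iff₀ (by nlinarith)]
  linarith

lemma integral_inner (h : IsSignPermInvariant ν) (s : EuclideanSpace ℝ (Fin p)) :
    ∫ x, inner ℝ s x ∂ν = 0 := by
  simp only [PiLp.inner_apply, RCLike.inner_apply, conj_trivial]
  rw [integral_finsetSum _ fun l _ => h.integrable (by fun_prop)]
  refine Finset.sum_eq_zero fun i _ => h.integral_eq_zero_of_flip i (by fun_prop) ?_
  intro x; simp

/-- Sums over coordinates outside `k` do not change when the sign of `x k` is reversed. -/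
lemma sum_flipCoord_of_notMem {A : Finset (Fin p)} {k : Fin p} (hk : k ∉ A)
    (s x : EuclideanSpace ℝ (Fin p)) :
    ∑ i ∈ A, s i * flipCoord k x i = ∑ i ∈ A, s i * x i :=
  Finset.sum_congr rfl fun i hi => by
    rw [flipCoord_apply, if_neg (ne_of_mem_of_not_mem hi hk)]

/-- Sign flips kill the cross terms. The weight `g` is 1 for second moments and x_k² for fourth
moments. -/
lemma integral_sum_sq (h : IsSignPermInvariant ν) (s : EuclideanSpace ℝ (Fin p))
    (A : Finset (Fin p)) {g : EuclideanSpace ℝ (Fin p) → ℝ} (hg : Continuous g)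
    (hgf : ∀ k ∈ A, ∀ x, g (flipCoord k x) = g x) :
    ∫ x, g x * (∑ i ∈ A, s i * x i) ^ 2 ∂ν = ∑ i ∈ A, s i ^ 2 * ∫ x, g x * x i ^ 2 ∂ν := by
  induction A using Finset.induction_on with
  | empty => simp
  | insert k A hk ih =>
    rw [Finset.sum_insert hk, ← ih fun i hi => hgf i (Finset.mem_insert_of_mem hi)]
    have h0 : ∫ x, g x * x k * (∑ i ∈ A, s i * x i) ∂ν = 0 :=
      h.integral_eq_zero_of_flip k (by fun_prop) fun x => by
        rw [sum_flipCoord_of_notMem hk, hgf k (Finset.mem_insert_self _ _)]; simp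
    have h1 : ∀ x : EuclideanSpace ℝ (Fin p), g x * (∑ i ∈ insert k A, s i * x i) ^ 2 =
        s k ^ 2 * (g x * x k ^ 2) + g x * (∑ i ∈ A, s i * x i) ^ 2
          + 2 * s k * (g x * x k * (∑ i ∈ A, s i * x i)) := fun x => by
      rw [Finset.sum_insert hk]; ring
    simp only [h1]
    rw [integral_add (h.integrable (by fun_prop)) (h.integrable (by fun_prop)),
      integral_add (h.integrable (by fun_prop)) (h.integrable (by fun_prop)),
      integral_const_mul, integral_const_mul, h0]
    ring

lemma integral_inner_sq (h : IsSignPermInvariant ν) (s : EuclideanSpace ℝ (Fin p)) :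
    ∫ x, inner ℝ s x ^ 2 ∂ν = ‖s‖ ^ 2 / p := by
  have := h.integral_sum_sq s Finset.univ (g := fun _ => 1) (by fun_prop) (by simp)
  simp only [one_mul, h.integral_coord_sq] at this
  simp only [PiLp.inner_apply, RCLike.inner_apply, conj_trivial, mul_comm _ (s.ofLp _)]
  rw [this, ← Finset.sum_mul, ← EuclideanSpace.real_norm_sq_eq]
  ring

/-- Coordinates are added one at a time; in the binomial expansion the terms odd in the new
coordinate vanish. -/
lemma integral_sum_pow_four_le (h : IsSignPermInvariant ν) (hp : 2 ≤ p)
    (s : EuclideanSpace ℝ (Fin p)) (A : Finset (Fin p)) :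
    ∫ x, (∑ i ∈ A, s i * x i) ^ 4 ∂ν ≤
      3 / (p * (p - 1)) * (∑ i ∈ A, s i ^ 2) ^ 2 + 1 / p * ∑ i ∈ A, s i ^ 4 := by
  have hp' : (2 : ℝ) ≤ p := by exact_mod_cast hp
  have hκ : (0 : ℝ) ≤ 1 / (p * (p - 1)) := div_nonneg zero_le_one (by nlinarith)
  induction A using Finset.induction_on with
  | empty => simp
  | insert k A hk ih =>
    have h0 : ∫ x, x k * (∑ i ∈ A, s i * x i) ^ 3 ∂ν = 0 :=
      h.integral_eq_zero_of_flip k (by fun_prop) fun x => by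
        rw [sum_flipCoord_of_notMem hk]; simp
    have h0' : ∫ x, x k ^ 3 * (∑ i ∈ A, s i * x i) ∂ν = 0 :=
      h.integral_eq_zero_of_flip k (by fun_prop) fun x => by
        rw [sum_flipCoord_of_notMem hk]; simp; ring
    have h2 : ∫ x, x k ^ 2 * (∑ i ∈ A, s i * x i) ^ 2 ∂ν ≤
        (1 / (p * (p - 1))) * ∑ i ∈ A, s i ^ 2 := by
      rw [h.integral_sum_sq s A (by fun_prop) fun i hi x => by
        simp [show k ≠ i from fun h => hk (h ▸ hi)], Finset.mul_sum]
      refine Finset.sum_le_sum fun i hi => ?_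
      have := h.integral_coord_sq_mul_sq_le (k := k) (l := i) fun h => hk (h ▸ hi)
      nlinarith [sq_nonneg (s i)]
    have h1 : ∀ x : EuclideanSpace ℝ (Fin p), (∑ i ∈ insert k A, s i * x i) ^ 4 =
        (∑ i ∈ A, s i * x i) ^ 4 + 6 * s k ^ 2 * (x k ^ 2 * (∑ i ∈ A, s i * x i) ^ 2)
          + s k ^ 4 * x k ^ 4 + 4 * s k * (x k * (∑ i ∈ A, s i * x i) ^ 3)
          + 4 * s k ^ 3 * (x k ^ 3 * (∑ i ∈ A, s i * x i)) := fun x => by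
      rw [Finset.sum_insert hk]; ring
    simp only [h1]
    rw [integral_add (h.integrable (by fun_prop)) (h.integrable (by fun_prop)),
      integral_add (h.integrable (by fun_prop)) (h.integrable (by fun_prop)),
      integral_add (h.integrable (by fun_prop)) (h.integrable (by fun_prop)),
      integral_add (h.integrable (by fun_prop)) (h.integrable (by fun_prop)),
      integral_const_mul, integral_const_mul, integral_const_mul, integral_const_mul, h0, h0',
      Finset.sum_insert hk, Finset.sum_insert hk]
    have h3 := mul_le_mul_of_nonneg_left h2 (by positivity : 0 ≤ 6 * s k ^ 2)
    have h4 := mul_le_mul_of_nonneg_left (h.integral_coord_pow_four_le k)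
      (by positivity : 0 ≤ s k ^ 4)
    -- Expanding the square in the bound yields the needed cross term 6 s_k² ∑ s_i² plus this
    -- nonnegative surplus.
    have h5 : 0 ≤ 1 / ((p : ℝ) * (p - 1)) * s k ^ 4 := by positivity
    have h6 : 3 / ((p : ℝ) * (p - 1)) = 3 * (1 / (p * (p - 1))) := by ring
    rw [h6] at ih ⊢
    nlinarith

lemma integral_inner_pow_four_le (h : IsSignPermInvariant ν) (hp : 2 ≤ p)
    (s : EuclideanSpace ℝ (Fin p)) :
    ∫ x, inner ℝ s x ^ 4 ∂ν ≤
      3 / (p * (p - 1)) * ‖s‖ ^ 4 + 1 / p * ∑ i, s i ^ 4 := by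
  have := h.integral_sum_pow_four_le hp s Finset.univ
  simp only [PiLp.inner_apply, RCLike.inner_apply, conj_trivial, mul_comm _ (s.ofLp _)]
  rwa [← EuclideanSpace.real_norm_sq_eq, ← pow_mul] at this

/-- Composing all the sign changes gives invariance under `x ↦ -x`. -/
lemma map_neg (h : IsSignPermInvariant ν) : ν.map (fun x => -x) = ν := by
  have key : ∀ A : Finset (Fin p), ν.map (fun x => WithLp.toLp 2
      (fun i => if i ∈ A then -x i else x i)) = ν := by
    intro A
    induction A using Finset.induction_on with
    | empty => simp
    | insert k A hk ih =>
      have hc : Measurable fun x : EuclideanSpace ℝ (Fin p) => (WithLp.toLp 2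
          (fun i => if i ∈ A then -x i else x i) : EuclideanSpace ℝ (Fin p)) := by
        refine (PiLp.continuous_toLp 2 _).measurable.comp (measurable_pi_lambda _ fun i => ?_)
        by_cases h : i ∈ A
        · simp only [h, if_true]; fun_prop
        · simp only [h, if_false]; fun_prop
      conv_rhs => rw [← h.map_flip k, ← ih]
      rw [Measure.map_map (continuous_flipCoord k).measurable hc]
      congr 1
      ext x i
      by_cases hi : i = k
      · subst hi; simp [hk]
      · simp [hi]
  have := key Finset.univ
  simp only [Finset.mem_univ, if_true] at this
  exact this

/-- The sine part is odd under x ↦ -x. -/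
lemma integral_exp_inner (h : IsSignPermInvariant ν) (s : EuclideanSpace ℝ (Fin p)) (u : ℝ) :
    ∫ x, Complex.exp ((u * inner ℝ s x : ℝ) * Complex.I) ∂ν =
      (∫ x, Real.cos (u * inner ℝ s x) ∂ν : ℝ) := by
  have h0 : ∫ x, Real.sin (u * inner ℝ s x) ∂ν = 0 := by
    have h1 : ∫ x, Real.sin (u * inner ℝ s x) ∂ν = ∫ x, Real.sin (u * inner ℝ s (-x)) ∂ν := by
      conv_lhs => rw [← h.map_neg]
      rw [integral_map (by fun_prop)
        (Continuous.aestronglyMeasurable (by fun_prop))]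
    simp only [inner_neg_right, mul_neg, Real.sin_neg, integral_neg] at h1
    linarith
  simp only [Complex.exp_mul_I, ← Complex.ofReal_cos, ← Complex.ofReal_sin]
  rw [integral_add (h.integrable (by fun_prop)) (h.integrable (by fun_prop)),
    integral_mul_const, integral_complex_ofReal, integral_complex_ofReal, h0]
  simp

end IsSignPermInvariant

/-! ### The walk (M_k, S_k) and its moments -/

/-- One step of the walk: from the current value `m` of the statistic and the current sum `s` of
the observations, a new observation `x` leads to `(m + ⟪s, x⟫, s + x)`. -/
noncomputable def walkStep {p : ℕ} (z : (ℝ × EuclideanSpace ℝ (Fin p)) × EuclideanSpace ℝ (Fin p)) :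
    ℝ × EuclideanSpace ℝ (Fin p) :=
  (z.1.1 + inner ℝ z.1.2 z.2, z.1.2 + z.2)

/-- The joint law of `∑ i < j < k, ⟪X i, X j⟫` and `∑ i < k, X i`, where the `X i` are i.i.d. with
law `ν`. -/
noncomputable def walkLaw {p : ℕ} (ν : Measure (EuclideanSpace ℝ (Fin p))) :
    ℕ → Measure (ℝ × EuclideanSpace ℝ (Fin p))
  | 0 => Measure.dirac 0
  | k + 1 => ((walkLaw ν k).prod ν).map walkStep

lemma continuous_walkStep {p : ℕ} : Continuous (walkStep (p := p)) := by
  unfold walkStep; fun_prop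

namespace IsSignPermInvariant

variable {p : ℕ} {ν : Measure (EuclideanSpace ℝ (Fin p))}

lemma isProbabilityMeasure_walkLaw (h : IsSignPermInvariant ν) (k : ℕ) :
    IsProbabilityMeasure (walkLaw ν k) := by
  have := h.isProbabilityMeasure
  induction k with
  | zero => exact Measure.dirac.isProbabilityMeasure
  | succ k ih => exact Measure.isProbabilityMeasure_map continuous_walkStep.aemeasurable

lemma exists_compact_walkLaw (h : IsSignPermInvariant ν) (k : ℕ) :
    ∃ K, IsCompact K ∧ ∀ᵐ z ∂walkLaw ν k, z ∈ K := by
  have := h.isProbabilityMeasure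
  induction k with
  | zero => exact ⟨{0}, isCompact_singleton, by simp [walkLaw]⟩
  | succ k ih =>
    have := h.isProbabilityMeasure_walkLaw k
    obtain ⟨K, hK, hK'⟩ := ih
    have hc : IsCompact (walkStep '' (K ×ˢ Metric.sphere (0 : EuclideanSpace ℝ (Fin p)) 1)) :=
      (hK.prod (isCompact_sphere 0 1)).image continuous_walkStep
    refine ⟨_, hc, ?_⟩
    refine (ae_map_iff continuous_walkStep.aemeasurable hc.isClosed.measurableSet).2 ?_
    have h1 : ∀ᵐ z ∂(walkLaw ν k).prod ν, z.1 ∈ K := Measure.quasiMeasurePreserving_fst.ae hK'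
    have h2 : ∀ᵐ z ∂(walkLaw ν k).prod ν, z.2 ∈ Metric.sphere (0 : EuclideanSpace ℝ (Fin p)) 1 :=
      Measure.quasiMeasurePreserving_snd.ae h.ae_mem_sphere
    filter_upwards [h1, h2] with z hz1 hz2
    exact Set.mem_image_of_mem _ ⟨hz1, hz2⟩

variable {F : Type*} [NormedAddCommGroup F]

lemma integrable_walkLaw (h : IsSignPermInvariant ν) (k : ℕ)
    {f : ℝ × EuclideanSpace ℝ (Fin p) → F} (hf : Continuous f) : Integrable f (walkLaw ν k) := by
  have := h.isProbabilityMeasure_walkLaw k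
  obtain ⟨K, hK, hK'⟩ := h.exists_compact_walkLaw k
  exact .of_continuous_of_ae_mem_isCompact hK hK' hf

lemma integrable_walkLaw_prod (h : IsSignPermInvariant ν) (k : ℕ)
    {f : (ℝ × EuclideanSpace ℝ (Fin p)) × EuclideanSpace ℝ (Fin p) → F} (hf : Continuous f) :
    Integrable f ((walkLaw ν k).prod ν) := by
  have := h.isProbabilityMeasure
  have := h.isProbabilityMeasure_walkLaw k
  obtain ⟨K, hK, hK'⟩ := h.exists_compact_walkLaw k
  refine .of_continuous_of_ae_mem_isCompact (hK.prod (isCompact_sphere 0 1)) ?_ hf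
  have h1 : ∀ᵐ z ∂(walkLaw ν k).prod ν, z.1 ∈ K := Measure.quasiMeasurePreserving_fst.ae hK'
  have h2 : ∀ᵐ z ∂(walkLaw ν k).prod ν, z.2 ∈ Metric.sphere (0 : EuclideanSpace ℝ (Fin p)) 1 :=
    Measure.quasiMeasurePreserving_snd.ae h.ae_mem_sphere
  filter_upwards [h1, h2] with z hz1 hz2
  exact ⟨hz1, hz2⟩

variable [NormedSpace ℝ F]

lemma integral_walkLaw_succ (h : IsSignPermInvariant ν) (k : ℕ)
    {f : ℝ × EuclideanSpace ℝ (Fin p) → F} (hf : Continuous f) :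
    ∫ z, f z ∂walkLaw ν (k + 1) =
      ∫ z, ∫ x, f (z.1 + inner ℝ z.2 x, z.2 + x) ∂ν ∂walkLaw ν k := by
  have := h.isProbabilityMeasure
  have := h.isProbabilityMeasure_walkLaw k
  rw [walkLaw, integral_map continuous_walkStep.aemeasurable]
  · exact integral_prod _ (h.integrable_walkLaw_prod k (hf.comp continuous_walkStep))
  · exact (h.integrable_walkLaw (k + 1) hf).aestronglyMeasurable

lemma integral_walkLaw_norm_sq (h : IsSignPermInvariant ν) (k : ℕ) :
    ∫ z, ‖z.2‖ ^ 2 ∂walkLaw ν k = k := by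
  have := h.isProbabilityMeasure
  induction k with
  | zero => simp [walkLaw]
  | succ k ih =>
    have := h.isProbabilityMeasure_walkLaw k
    rw [h.integral_walkLaw_succ k (by fun_prop)]
    have h1 : ∀ s : EuclideanSpace ℝ (Fin p), ∫ x, ‖s + x‖ ^ 2 ∂ν = ‖s‖ ^ 2 + 1 := fun s => by
      have : ∀ᵐ x ∂ν, ‖s + x‖ ^ 2 = ‖s‖ ^ 2 + 1 + 2 * inner ℝ s x := by
        filter_upwards [h.ae_norm] with x hx
        rw [norm_add_sq_real, hx]; ring
      rw [integral_congr_ae this, integral_add (by simp) (h.integrable (by fun_prop)),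
        integral_const_mul, h.integral_inner]
      simp
    simp only [h1]
    rw [integral_add (h.integrable_walkLaw k (by fun_prop)) (by simp), ih]
    simp

/-- The squared norm of the walk concentrates around its mean. -/
lemma integral_walkLaw_norm_sq_sub_sq_le (h : IsSignPermInvariant ν) (k : ℕ) :
    ∫ z, (‖z.2‖ ^ 2 - k) ^ 2 ∂walkLaw ν k ≤ 2 * k ^ 2 / p := by
  have := h.isProbabilityMeasure
  induction k with
  | zero => simp [walkLaw]
  | succ k ih =>
    have := h.isProbabilityMeasure_walkLaw k
    rw [h.integral_walkLaw_succ k (by fun_prop)]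
    -- ‖S_k‖² - k is a martingale with increments 2⟪S_k, X_{k+1}⟫, of conditional variance
    -- 4‖S_k‖²/p.
    have h1 : ∀ s : EuclideanSpace ℝ (Fin p), ∫ x, (‖s + x‖ ^ 2 - (k + 1 : ℕ)) ^ 2 ∂ν =
        (‖s‖ ^ 2 - k) ^ 2 + 4 / p * ‖s‖ ^ 2 := fun s => by
      have : ∀ᵐ x ∂ν, (‖s + x‖ ^ 2 - (k + 1 : ℕ)) ^ 2 = (‖s‖ ^ 2 - k) ^ 2 +
          4 * (‖s‖ ^ 2 - k) * inner ℝ s x + 4 * inner ℝ s x ^ 2 := by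
        filter_upwards [h.ae_norm] with x hx
        rw [norm_add_sq_real, hx]; push_cast; ring
      rw [integral_congr_ae this,
        integral_add (h.integrable (by fun_prop)) (h.integrable (by fun_prop)),
        integral_add (by simp) (h.integrable (by fun_prop)),
        integral_const_mul, integral_const_mul, h.integral_inner, h.integral_inner_sq]
      simp only [integral_const, probReal_univ, smul_eq_mul]
      ring
    simp only [h1]
    rw [integral_add (h.integrable_walkLaw k (by fun_prop))
      (h.integrable_walkLaw k (by fun_prop)), integral_const_mul, h.integral_walkLaw_norm_sq]
    have h2 : (2 * ((k + 1 : ℕ) : ℝ) ^ 2 / p) = 2 * k ^ 2 / p + 4 / p * k + 2 / p := by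
      push_cast; ring
    rw [h2]
    have : (0 : ℝ) ≤ 2 / p := by positivity
    linarith

lemma integral_walkLaw_norm_pow_four_le (h : IsSignPermInvariant ν) (hp : 1 ≤ p) (k : ℕ) :
    ∫ z, ‖z.2‖ ^ 4 ∂walkLaw ν k ≤ 3 * k ^ 2 := by
  have := h.isProbabilityMeasure_walkLaw k
  have h1 : ∀ z : ℝ × EuclideanSpace ℝ (Fin p),
      ‖z.2‖ ^ 4 = (‖z.2‖ ^ 2 - k) ^ 2 + 2 * k * ‖z.2‖ ^ 2 - k ^ 2 := fun z => by ring
  simp only [h1]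
  rw [integral_sub (h.integrable_walkLaw k (by fun_prop)) (by simp),
    integral_add (h.integrable_walkLaw k (by fun_prop)) (h.integrable_walkLaw k (by fun_prop)),
    integral_const_mul, h.integral_walkLaw_norm_sq]
  have h2 := h.integral_walkLaw_norm_sq_sub_sq_le k
  have h3 : 2 * (k : ℝ) ^ 2 / p ≤ 2 * k ^ 2 :=
    div_le_self (by positivity) (by exact_mod_cast hp)
  simp only [integral_const, probReal_univ, smul_eq_mul]
  nlinarith

lemma integral_walkLaw_coord_sq_sum (h : IsSignPermInvariant ν) (k : ℕ) :
    ∑ l, ∫ z, z.2 l ^ 2 ∂walkLaw ν k = k := by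
  rw [← integral_finsetSum _ fun l _ => h.integrable_walkLaw k (by fun_prop),
    ← h.integral_walkLaw_norm_sq k]
  simp only [EuclideanSpace.real_norm_sq_eq]

/-- The crude bound ∑ s_l⁴ ≤ ‖s‖⁴ would produce a total error of order p/n; the gain here is what
allows p = o(n²). -/
lemma integral_walkLaw_coord_pow_four_sum_le (h : IsSignPermInvariant ν) (k : ℕ) :
    ∑ l, ∫ z, z.2 l ^ 4 ∂walkLaw ν k ≤ k + 3 * k ^ 2 / p := by
  have := h.isProbabilityMeasure
  induction k with
  | zero => simp [walkLaw]
  | succ k ih =>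
    have := h.isProbabilityMeasure_walkLaw k
    have h1 : ∀ l, ∫ z, z.2 l ^ 4 ∂walkLaw ν (k + 1) =
        ∫ z, z.2 l ^ 4 ∂walkLaw ν k + 6 / p * ∫ z, z.2 l ^ 2 ∂walkLaw ν k +
          ∫ x, x l ^ 4 ∂ν := fun l => by
      rw [h.integral_walkLaw_succ k (by fun_prop)]
      have h2 : ∀ s : EuclideanSpace ℝ (Fin p), ∫ x, (s + x) l ^ 4 ∂ν =
          s l ^ 4 + 6 / p * s l ^ 2 + ∫ x, x l ^ 4 ∂ν := fun s => by
        have e : ∀ x : EuclideanSpace ℝ (Fin p), (s + x) l ^ 4 = s l ^ 4 + 4 * s l ^ 3 * x l +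
            6 * s l ^ 2 * x l ^ 2 + 4 * s l * x l ^ 3 + x l ^ 4 := fun x => by
          rw [PiLp.add_apply]; ring
        have e1 : ∫ x, x l ∂ν = 0 := h.integral_eq_zero_of_flip l (by fun_prop) (by simp)
        have e3 : ∫ x, x l ^ 3 ∂ν = 0 :=
          h.integral_eq_zero_of_flip l (by fun_prop) (by intro x; simp; ring)
        simp only [e]
        rw [integral_add (h.integrable (by fun_prop)) (h.integrable (by fun_prop)),
          integral_add (h.integrable (by fun_prop)) (h.integrable (by fun_prop)),
          integral_add (h.integrable (by fun_prop)) (h.integrable (by fun_prop)),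
          integral_add (by simp) (h.integrable (by fun_prop)),
          integral_const_mul, integral_const_mul, integral_const_mul, e1, e3, h.integral_coord_sq]
        simp only [integral_const, probReal_univ, smul_eq_mul]
        ring
      simp only [h2]
      rw [integral_add (h.integrable_walkLaw k (by fun_prop)) (by simp),
        integral_add (h.integrable_walkLaw k (by fun_prop)) (h.integrable_walkLaw k (by fun_prop)),
        integral_const_mul]
      simp
    simp only [h1]
    rw [Finset.sum_add_distrib, Finset.sum_add_distrib, ← Finset.mul_sum,
      h.integral_walkLaw_coord_sq_sum]
    have h3 := h.integral_sum_coord_pow_four_le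
    have h4 : (3 * ((k + 1 : ℕ) : ℝ) ^ 2 / p) = 3 * k ^ 2 / p + 6 / p * k + 3 / p := by
      push_cast; ring
    have : (0 : ℝ) ≤ 3 / p := by positivity
    rw [h4]
    push_cast
    linarith

lemma integral_walkLaw_inner_pow_four_le (h : IsSignPermInvariant ν) (hp : 2 ≤ p) (k : ℕ) :
    ∫ z, ∫ x, inner ℝ z.2 x ^ 4 ∂ν ∂walkLaw ν k ≤ 21 * k ^ 2 / p ^ 2 + k / p := by
  have := h.isProbabilityMeasure
  have := h.isProbabilityMeasure_walkLaw k
  have hp' : (2 : ℝ) ≤ p := by exact_mod_cast hp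
  calc _ ≤ ∫ z, (3 / (p * (p - 1)) * ‖z.2‖ ^ 4 + 1 / p * ∑ i, z.2 i ^ 4) ∂walkLaw ν k := by
        refine integral_mono_ae ?_ (h.integrable_walkLaw k (by fun_prop))
          (.of_forall fun z => h.integral_inner_pow_four_le hp z.2)
        exact (h.integrable_walkLaw_prod k (f := fun z => inner ℝ z.1.2 z.2 ^ 4)
          (by fun_prop)).integral_prod_left
    _ = 3 / (p * (p - 1)) * ∫ z, ‖z.2‖ ^ 4 ∂walkLaw ν k +
        1 / p * ∑ i, ∫ z, z.2 i ^ 4 ∂walkLaw ν k := by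
        rw [integral_add (h.integrable_walkLaw k (by fun_prop))
          (h.integrable_walkLaw k (by fun_prop)), integral_const_mul, integral_const_mul,
          integral_finsetSum _ fun l _ => h.integrable_walkLaw k (by fun_prop)]
    -- p - 1 ≥ p/2 turns 3/(p(p - 1)) into 6/p²; the final 21 is 6·3 + 3.
    _ ≤ 6 / p ^ 2 * (3 * k ^ 2) + 1 / p * (k + 3 * k ^ 2 / p) := by
        refine add_le_add (mul_le_mul ?_ (h.integral_walkLaw_norm_pow_four_le (by omega) k)
          (integral_nonneg fun z => by positivity) (by positivity))
          (mul_le_mul_of_nonneg_left (h.integral_walkLaw_coord_pow_four_sum_le k) (by positivity))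
        rw [div_le_div_iff₀ (by nlinarith) (by positivity)]
        nlinarith
    _ = _ := by field_simp; ring

lemma integral_walkLaw_abs_norm_sq_sub_le (h : IsSignPermInvariant ν) (hp : 1 ≤ p) {n k : ℕ}
    (hk : k < n) : ∫ z, |‖z.2‖ ^ 2 - k| ∂walkLaw ν k ≤ 2 * n / √p := by
  have := h.isProbabilityMeasure_walkLaw k
  have hp' : (0 : ℝ) < p := by exact_mod_cast hp
  have hn : (0 : ℝ) < n := by exact_mod_cast (by omega : 0 < n)
  have hs : 0 < √(p : ℝ) := Real.sqrt_pos.2 hp'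
  have hkn : (k : ℝ) ≤ n := by exact_mod_cast hk.le
  -- AM-GM, balanced at the scale n/√p of the standard deviation of ‖S_k‖².
  have hamgm : ∀ y : ℝ, |y| ≤ n / √p / 2 + √p / n / 2 * y ^ 2 := fun y => by
    have : (√p / n / 2) * (|y| - n / √p) ^ 2 = √p / n / 2 * y ^ 2 + n / √p / 2 - |y| := by
      rw [sub_sq, sq_abs]; field_simp; ring
    have : 0 ≤ (√p / n / 2) * (|y| - n / √p) ^ 2 := by positivity
    linarith
  calc _ ≤ ∫ z, (n / √p / 2 + √p / n / 2 * (‖z.2‖ ^ 2 - k) ^ 2) ∂walkLaw ν k :=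
        integral_mono (h.integrable_walkLaw k (by fun_prop)) (h.integrable_walkLaw k (by fun_prop))
          fun z => hamgm _
    _ = n / √p / 2 + √p / n / 2 * ∫ z, (‖z.2‖ ^ 2 - k) ^ 2 ∂walkLaw ν k := by
        rw [integral_add (by simp) (h.integrable_walkLaw k (by fun_prop)), integral_const_mul]
        simp
    _ ≤ n / √p / 2 + √p / n / 2 * (2 * n ^ 2 / p) := by
        gcongr
        refine (h.integral_walkLaw_norm_sq_sub_sq_le k).trans ?_
        gcongr
    _ = 3 / 2 * (n / √p) := by
        have : (p : ℝ) = √p ^ 2 := (Real.sq_sqrt hp'.le).symm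
        rw [this, Real.sqrt_sq hs.le]
        field_simp; ring
    _ ≤ _ := by
        have : 0 ≤ n / √p := by positivity
        rw [mul_div_assoc]; linarith

end IsSignPermInvariant

/-! ### Recursion for the characteristic function -/

/-- Being valid for all y, the bound can be integrated without truncation. -/
lemma Real.abs_cos_sub_one_sub_sq_div_two_le (y : ℝ) :
    |Real.cos y - (1 - y ^ 2 / 2)| ≤ 3 * y ^ 4 := by
  rcases le_total |y| 1 with hy | hy
  · refine (Real.cos_bound hy).trans ?_
    have : |y| ^ 4 = y ^ 4 := by rw [← abs_pow]; exact abs_of_nonneg (by positivity)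
    rw [this]
    nlinarith [show (0 : ℝ) ≤ y ^ 4 by positivity]
  · have h1 : 1 ≤ y ^ 2 := (one_le_sq_iff_one_le_abs y).2 hy
    have h2 := Real.one_sub_sq_div_two_le_cos (x := y)
    have h3 := Real.cos_le_one y
    rw [abs_le]
    constructor <;> nlinarith

lemma Real.abs_one_sub_sub_exp_neg_le {a : ℝ} (ha : 0 ≤ a) : |(1 - a) - Real.exp (-a)| ≤ a ^ 2 := by
  rcases le_total a 1 with h | h
  · have := Real.abs_exp_sub_one_sub_id_le (x := -a) (by rwa [abs_neg, abs_of_nonneg ha])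
    rw [abs_sub_comm]
    rw [neg_sq] at this
    convert this using 2
    ring
  · have h1 : Real.exp (-a) ≤ 1 := Real.exp_le_one_iff.2 (by linarith)
    have h2 := Real.exp_pos (-a)
    rw [abs_le]
    constructor <;> nlinarith

namespace IsSignPermInvariant

variable {p : ℕ} {ν : Measure (EuclideanSpace ℝ (Fin p))}

lemma abs_integral_cos_inner_sub_le (h : IsSignPermInvariant ν) (s : EuclideanSpace ℝ (Fin p))
    (u : ℝ) : |∫ x, Real.cos (u * inner ℝ s x) ∂ν - (1 - u ^ 2 / (2 * p) * ‖s‖ ^ 2)| ≤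
      3 * u ^ 4 * ∫ x, inner ℝ s x ^ 4 ∂ν := by
  have := h.isProbabilityMeasure
  have h1 : (1 - u ^ 2 / (2 * p) * ‖s‖ ^ 2) = ∫ x, (1 - (u * inner ℝ s x) ^ 2 / 2) ∂ν := by
    have e : ∀ x : EuclideanSpace ℝ (Fin p), 1 - (u * inner ℝ s x) ^ 2 / 2 =
        1 - u ^ 2 / 2 * inner ℝ s x ^ 2 := fun x => by ring
    simp only [e]
    rw [integral_sub (by simp) (h.integrable (by fun_prop)), integral_const_mul,
      h.integral_inner_sq]
    simp only [integral_const, probReal_univ, smul_eq_mul]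
    ring
  rw [h1, ← integral_sub (h.integrable (by fun_prop)) (h.integrable (by fun_prop)),
    ← integral_const_mul]
  refine abs_integral_le_integral_abs.trans
    (integral_mono (h.integrable (by fun_prop)) (h.integrable (by fun_prop)) fun x => ?_)
  refine (Real.abs_cos_sub_one_sub_sq_div_two_le _).trans (le_of_eq ?_)
  ring

lemma norm_integral_exp_walkLaw_le (h : IsSignPermInvariant ν) (k : ℕ) (u : ℝ) :
    ‖∫ z, Complex.exp ((u * z.1 : ℝ) * Complex.I) ∂walkLaw ν k‖ ≤ 1 := by
  have := h.isProbabilityMeasure_walkLaw k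
  refine (norm_integral_le_of_norm_le_const (C := 1) (.of_forall fun z => ?_)).trans (by simp)
  rw [Complex.norm_exp_ofReal_mul_I]

/-- Conditioning on the past leaves a unimodular phase times a real cosine integral. The first error
comes from replacing ‖S_k‖² by k, the second from the Taylor remainder of the cosine. -/
lemma norm_integral_exp_walkLaw_succ_sub_le (h : IsSignPermInvariant ν) (hp : 2 ≤ p) {n k : ℕ}
    (hk : k < n) (u : ℝ) :
    ‖∫ z, Complex.exp ((u * z.1 : ℝ) * Complex.I) ∂walkLaw ν (k + 1) -
        (1 - u ^ 2 / (2 * p) * k : ℝ) *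
          ∫ z, Complex.exp ((u * z.1 : ℝ) * Complex.I) ∂walkLaw ν k‖ ≤
      u ^ 2 / (2 * p) * (2 * n / √p) + 3 * u ^ 4 * (21 * n ^ 2 / p ^ 2 + n / p) := by
  have := h.isProbabilityMeasure
  have := h.isProbabilityMeasure_walkLaw k
  have hkn : (k : ℝ) ≤ n := by exact_mod_cast hk.le
  have e1 : ∀ z : ℝ × EuclideanSpace ℝ (Fin p),
      ∫ x, Complex.exp ((u * (z.1 + inner ℝ z.2 x) : ℝ) * Complex.I) ∂ν =
      Complex.exp ((u * z.1 : ℝ) * Complex.I) * (∫ x, Real.cos (u * inner ℝ z.2 x) ∂ν : ℝ) := by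
    intro z
    rw [← h.integral_exp_inner, ← integral_const_mul]
    congr 1 with x
    rw [← Complex.exp_add]
    congr 1
    push_cast; ring
  have hi1 : Integrable (fun z : ℝ × EuclideanSpace ℝ (Fin p) =>
      Complex.exp ((u * z.1 : ℝ) * Complex.I) * (∫ x, Real.cos (u * inner ℝ z.2 x) ∂ν : ℝ))
      (walkLaw ν k) := by
    simp only [← e1]
    exact (h.integrable_walkLaw_prod k (f := fun z => Complex.exp
      ((u * (z.1.1 + inner ℝ z.1.2 z.2) : ℝ) * Complex.I)) (by fun_prop)).integral_prod_left
  have hi2 : Integrable (fun z : ℝ × EuclideanSpace ℝ (Fin p) =>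
      ∫ x, inner ℝ z.2 x ^ 4 ∂ν) (walkLaw ν k) :=
    (h.integrable_walkLaw_prod k (f := fun z => inner ℝ z.1.2 z.2 ^ 4)
      (by fun_prop)).integral_prod_left
  rw [h.integral_walkLaw_succ k (by fun_prop)]
  simp only [e1]
  rw [← integral_const_mul, ← integral_sub hi1 (h.integrable_walkLaw k (by fun_prop))]
  calc _ ≤ ∫ z, (u ^ 2 / (2 * p) * |‖z.2‖ ^ 2 - k| + 3 * u ^ 4 * ∫ x, inner ℝ z.2 x ^ 4 ∂ν)
        ∂walkLaw ν k := by
        refine norm_integral_le_of_norm_le ((h.integrable_walkLaw k (by fun_prop)).add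
          (hi2.const_mul _)) (.of_forall fun z => ?_)
        rw [mul_comm (Complex.ofReal (1 - _)), ← mul_sub, norm_mul,
          Complex.norm_exp_ofReal_mul_I, one_mul, ← Complex.ofReal_sub, Complex.norm_real,
          Real.norm_eq_abs]
        have h1 := h.abs_integral_cos_inner_sub_le z.2 u
        have h2 : |(1 - u ^ 2 / (2 * p) * ‖z.2‖ ^ 2) - (1 - u ^ 2 / (2 * p) * k)| =
            u ^ 2 / (2 * p) * |‖z.2‖ ^ 2 - k| := by
          conv_rhs => rw [← abs_of_nonneg (by positivity : 0 ≤ u ^ 2 / (2 * p)), ← abs_mul,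
            ← abs_neg]
          congr 1
          ring
        have h3 := abs_sub_le (∫ x, Real.cos (u * inner ℝ z.2 x) ∂ν)
          (1 - u ^ 2 / (2 * p) * ‖z.2‖ ^ 2) (1 - u ^ 2 / (2 * p) * k)
        linarith
    _ = u ^ 2 / (2 * p) * ∫ z, |‖z.2‖ ^ 2 - k| ∂walkLaw ν k +
        3 * u ^ 4 * ∫ z, ∫ x, inner ℝ z.2 x ^ 4 ∂ν ∂walkLaw ν k := by
        rw [integral_add (h.integrable_walkLaw k (by fun_prop)) (hi2.const_mul _),
          integral_const_mul, integral_const_mul]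
    _ ≤ _ := by
        have h1 := h.integral_walkLaw_abs_norm_sq_sub_le (by omega) hk
        have h2 := h.integral_walkLaw_inner_pow_four_le hp k
        have h3 : 21 * (k : ℝ) ^ 2 / p ^ 2 + k / p ≤ 21 * n ^ 2 / p ^ 2 + n / p := by gcongr
        have h4 := h2.trans h3
        gcongr

/-- A quantitative central limit theorem for the characteristic function. -/
lemma norm_integral_exp_walkLaw_sub_le (h : IsSignPermInvariant ν) (hp : 2 ≤ p) {n : ℕ}
    (hn : 1 ≤ n) (t : ℝ) :
    ‖∫ z, Complex.exp ((t * (√(2 * p) / n * z.1) : ℝ) * Complex.I) ∂walkLaw ν n -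
        (Real.exp (-(t ^ 2 / 2 * (1 - 1 / n))) : ℝ)‖ ≤
      2 * t ^ 2 / √p + 253 * t ^ 4 / n + 12 * t ^ 4 * (p / n ^ 2) := by
  have hn' : (0 : ℝ) < n := by exact_mod_cast hn
  have hp' : (0 : ℝ) < p := by exact_mod_cast (by omega : 0 < p)
  set u := t * (√(2 * p) / n) with hu
  have hu2 : u ^ 2 / (2 * p) = t ^ 2 / n ^ 2 := by
    rw [hu, mul_pow, div_pow, Real.sq_sqrt (by positivity)]
    field_simp
  have hu4 : u ^ 4 = 4 * t ^ 4 * p ^ 2 / n ^ 4 := by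
    rw [show u ^ 4 = (u ^ 2) ^ 2 by ring, hu, mul_pow, div_pow, Real.sq_sqrt (by positivity)]
    field_simp; ring
  set φ : ℕ → ℂ := fun k => ∫ z, Complex.exp ((u * z.1 : ℝ) * Complex.I) ∂walkLaw ν k with hφ
  -- Error per step: 253 = 3·4·21 + 1, the 1 coming from replacing 1 - a by exp(-a).
  set err : ℝ := 2 * t ^ 2 / (n * √p) + 253 * t ^ 4 / n ^ 2 + 12 * t ^ 4 * (p / n ^ 3) with herr
  have step : ∀ k < n, ‖φ (k + 1) - (Real.exp (-(t ^ 2 / n ^ 2 * k)) : ℝ) * φ k‖ ≤ err := by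
    intro k hk
    have hkn : (k : ℝ) ≤ n := by exact_mod_cast hk.le
    have h1 := h.norm_integral_exp_walkLaw_succ_sub_le hp hk u
    rw [hu2, hu4] at h1
    have h2 : ‖((1 - t ^ 2 / n ^ 2 * k : ℝ) : ℂ) * φ k -
        (Real.exp (-(t ^ 2 / n ^ 2 * k)) : ℝ) * φ k‖ ≤ t ^ 4 / n ^ 2 := by
      rw [← sub_mul, norm_mul, ← Complex.ofReal_sub, Complex.norm_real, Real.norm_eq_abs]
      calc _ ≤ (t ^ 2 / n ^ 2 * k) ^ 2 * 1 :=
            mul_le_mul (Real.abs_one_sub_sub_exp_neg_le (by positivity))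
              (h.norm_integral_exp_walkLaw_le k u) (norm_nonneg _) (by positivity)
        _ ≤ (t ^ 2 / n ^ 2 * n) ^ 2 * 1 := by gcongr
        _ = _ := by field_simp
    refine (norm_sub_le_norm_sub_add_norm_sub _ _ _).trans ((add_le_add h1 h2).trans
      (le_of_eq ?_))
    rw [herr]
    field_simp
    ring
  -- k(k - 1)/2 = 0 + 1 + ... + (k - 1). All factors are at most 1, so the errors merely add up.
  have key : ∀ k ≤ n, ‖φ k - (Real.exp (-(t ^ 2 / n ^ 2 * (k * (k - 1) / 2))) : ℝ)‖ ≤ k * err := by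
    intro k
    induction k with
    | zero => intro _; simp [hφ, walkLaw]
    | succ k ih =>
      intro hk
      have h1 := step k (by omega)
      have h2 := ih (by omega)
      have h3 : Real.exp (-(t ^ 2 / n ^ 2 * (((k + 1 : ℕ) : ℝ) * ((k + 1 : ℕ) - 1) / 2))) =
          Real.exp (-(t ^ 2 / n ^ 2 * k)) * Real.exp (-(t ^ 2 / n ^ 2 * (k * (k - 1) / 2))) := by
        rw [← Real.exp_add]; congr 1; push_cast; ring
      rw [h3, Complex.ofReal_mul]
      refine (norm_sub_le_norm_sub_add_norm_sub _
        ((Real.exp (-(t ^ 2 / n ^ 2 * k)) : ℝ) * φ k) _).trans ?_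
      rw [← mul_sub, norm_mul, Complex.norm_real, Real.norm_eq_abs, Real.abs_exp]
      have h4 : Real.exp (-(t ^ 2 / n ^ 2 * k)) ≤ 1 :=
        Real.exp_le_one_iff.2 (neg_nonpos.2 (by positivity))
      have h5 := mul_le_mul h4 h2 (norm_nonneg _) zero_le_one
      rw [Nat.cast_succ]
      linarith
  have hfin := key n le_rfl
  have e1 : t ^ 2 / (n : ℝ) ^ 2 * (n * (n - 1) / 2) = t ^ 2 / 2 * (1 - 1 / n) := by field_simp
  have e2 : n * err = 2 * t ^ 2 / √p + 253 * t ^ 4 / n + 12 * t ^ 4 * (p / n ^ 2) := by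
    rw [herr]; field_simp
  rw [e1, e2] at hfin
  have e3 : ∀ z : ℝ × EuclideanSpace ℝ (Fin p), t * (√(2 * p) / n * z.1) = u * z.1 := fun z => by
    rw [hu]; ring
  simpa only [e3] using hfin

end IsSignPermInvariant

/-! ### From i.i.d. samples to the walk -/

lemma rayleigh_eq_sum_Iio {n p : ℕ} (x : Fin n → EuclideanSpace ℝ (Fin p)) :
    rayleigh x = √(2 * p) / n * ∑ j : Fin n, ∑ i ∈ Finset.Iio j, inner ℝ (x i) (x j) := by
  rw [rayleigh]
  congr 1
  exact Finset.sum_comm' (by simp)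

namespace IsIIDSample

variable {Ω : Type*} [MeasurableSpace Ω] {P : Measure Ω} {n p : ℕ}
  {X : Fin n → Ω → EuclideanSpace ℝ (Fin p)} {ν : Measure (EuclideanSpace ℝ (Fin p))}

lemma map_prod_eq [IsProbabilityMeasure P] (hX : IsIIDSample P X ν) {F : Type*} [MeasurableSpace F]
    {g : (Fin n → EuclideanSpace ℝ (Fin p)) → F} (hg : Measurable g) (k : Fin n)
    (hgk : ∀ x y, (∀ i < k, x i = y i) → g x = g y) :
    P.map (fun ω => (g fun i => X i ω, X k ω)) = (P.map fun ω => g fun i => X i ω).prod ν := by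
  have hm : ∀ i, AEMeasurable (X i) P := fun i => (hX.hasLaw i).aemeasurable
  have hind := hX.indep.indepFun_finset₀ (Finset.Iio k) {k} (by simp) hm
  -- The value 0 at indices from `k` on is harmless: by `hgk`, `g` ignores them.
  let ext : (Finset.Iio k → EuclideanSpace ℝ (Fin p)) → Fin n → EuclideanSpace ℝ (Fin p) :=
    fun y i => if h : i ∈ Finset.Iio k then y ⟨i, h⟩ else 0
  have hext : Measurable ext := by
    refine measurable_pi_lambda _ fun i => ?_
    by_cases h : i ∈ Finset.Iio k
    · simp only [ext, h, dif_pos]; fun_prop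
    · simp only [ext, h, dif_neg, not_false_eq_true]; fun_prop
  have h1 := hind.comp (hg.comp hext)
    (measurable_pi_apply (⟨k, Finset.mem_singleton_self k⟩ : ({k} : Finset (Fin n))))
  have h2 : ((g ∘ ext) ∘ fun ω (i : Finset.Iio k) => X i ω) = fun ω => g fun i => X i ω := by
    ext1 ω
    refine hgk _ _ fun i hi => ?_
    simp [ext, hi]
  rw [h2] at h1
  have h3 : IndepFun (fun ω => g fun i => X i ω) (X k) P := h1
  have hgX : AEMeasurable (fun ω => g fun i => X i ω) P :=
    hg.comp_aemeasurable (aemeasurable_pi_lambda _ hm)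
  rw [h3.map_prod_eq_prod_map_map hgX (hm k), (hX.hasLaw k).map_eq]

lemma map_eq_walkLaw [IsProbabilityMeasure P] (hX : IsIIDSample P X ν) {k : ℕ} (hk : k ≤ n) :
    P.map (fun ω => (∑ j : Fin n with j.val < k, ∑ i ∈ Finset.Iio j, inner ℝ (X i ω) (X j ω),
      ∑ i : Fin n with i.val < k, X i ω)) = walkLaw ν k := by
  induction k with
  | zero => simp [walkLaw, Measure.map_const, Prod.zero_eq_mk]
  | succ k ih =>
    let g : (Fin n → EuclideanSpace ℝ (Fin p)) → ℝ × EuclideanSpace ℝ (Fin p) := fun x =>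
      (∑ j : Fin n with j.val < k, ∑ i ∈ Finset.Iio j, inner ℝ (x i) (x j),
        ∑ i : Fin n with i.val < k, x i)
    have hg : Continuous g := by fun_prop
    have hfil : (Finset.univ.filter fun i : Fin n => i.val < k + 1) =
        insert ⟨k, hk⟩ (Finset.univ.filter fun i : Fin n => i.val < k) := by
      ext i; simp [Fin.ext_iff]; omega
    have hIio : Finset.Iio (⟨k, hk⟩ : Fin n) = Finset.univ.filter fun i : Fin n => i.val < k := by
      ext i; simp [Fin.lt_def]
    have h1 := hX.map_prod_eq hg.measurable ⟨k, hk⟩ fun x y hxy => by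
      simp only [g]
      congr 1
      · refine Finset.sum_congr rfl fun j hj => Finset.sum_congr rfl fun i hi => ?_
        have hj' : j < ⟨k, hk⟩ := by simpa [Fin.lt_def] using hj
        rw [hxy j hj', hxy i ((Finset.mem_Iio.1 hi).trans hj')]
      · refine Finset.sum_congr rfl fun j hj => ?_
        rw [hxy j (by simpa [Fin.lt_def] using hj)]
    have h2 : P.map (fun ω => g fun i => X i ω) = walkLaw ν k := ih (by omega)
    rw [h2] at h1
    have hm : ∀ i, AEMeasurable (X i) P := fun i => (hX.hasLaw i).aemeasurable
    have hgX : AEMeasurable (fun ω => g fun i => X i ω) P :=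
      hg.measurable.comp_aemeasurable (aemeasurable_pi_lambda _ hm)
    rw [walkLaw, ← h1, AEMeasurable.map_map_of_aemeasurable continuous_walkStep.aemeasurable
      (hgX.prodMk (hm _))]
    congr 1
    ext1 ω
    simp only [Function.comp_apply, walkStep, g]
    rw [hfil, Finset.sum_insert (by simp), Finset.sum_insert (by simp), hIio, sum_inner,
      add_comm, add_comm (X _ ω)]

lemma aemeasurable_rayleigh (hX : IsIIDSample P X ν) :
    AEMeasurable (fun ω => rayleigh fun i => X i ω) P := by
  have hm : ∀ i, AEMeasurable (X i) P := fun i => (hX.hasLaw i).aemeasurable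
  have hr : Continuous (rayleigh (n := n) (p := p)) := by unfold rayleigh; fun_prop
  exact hr.measurable.comp_aemeasurable (aemeasurable_pi_lambda _ hm)

lemma charFun_rayleigh [IsProbabilityMeasure P] (hX : IsIIDSample P X ν) (t : ℝ) :
    charFun (P.map fun ω => rayleigh fun i => X i ω) t =
      ∫ z, Complex.exp ((t * (√(2 * p) / n * z.1) : ℝ) * Complex.I) ∂walkLaw ν n := by
  have hm : ∀ i, AEMeasurable (X i) P := fun i => (hX.hasLaw i).aemeasurable
  rw [charFun_apply_real, ← hX.map_eq_walkLaw le_rfl,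
    integral_map hX.aemeasurable_rayleigh (Continuous.aestronglyMeasurable (by fun_prop)),
    integral_map]
  · simp [rayleigh_eq_sum_Iio]
  · have hg : Continuous fun x : Fin n → EuclideanSpace ℝ (Fin p) =>
        (∑ j : Fin n with j.val < n, ∑ i ∈ Finset.Iio j, inner ℝ (x i) (x j),
          ∑ i : Fin n with i.val < n, x i) := by fun_prop
    exact hg.measurable.comp_aemeasurable (aemeasurable_pi_lambda _ hm)
  · exact Continuous.aestronglyMeasurable (by fun_prop)

end IsIIDSample

/-! ### The central limit theorem -/

/-- The central limit theorem for the Rayleigh statistic of i.i.d. samples from distributions on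
the sphere that are invariant under sign changes and permutations of the coordinates. -/
theorem tendstoInDistribution_rayleigh
    (p : ℕ → ℕ) (hp : Tendsto p atTop atTop)
    (hpn : Tendsto (fun n : ℕ => (p n : ℝ) / (n : ℝ) ^ 2) atTop (𝓝 0))
    (ν : (n : ℕ) → Measure (EuclideanSpace ℝ (Fin (p n))))
    (hν : ∀ᶠ n in atTop, IsSignPermInvariant (ν n))
    {Ω : ℕ → Type*} [∀ n, MeasurableSpace (Ω n)]
    (P : (n : ℕ) → Measure (Ω n)) [∀ n, IsProbabilityMeasure (P n)]
    (X : (n : ℕ) → Fin n → Ω n → EuclideanSpace ℝ (Fin (p n)))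
    (hX : ∀ n, IsIIDSample (P n) (X n) (ν n)) :
    TendstoInDistribution (fun n ω => rayleigh (fun i => X n i ω)) atTop (id : ℝ → ℝ) P
      (gaussianReal 0 1) where
  forall_aemeasurable n := (hX n).aemeasurable_rayleigh
  aemeasurable_limit := aemeasurable_id
  tendsto := by
    refine ProbabilityMeasure.tendsto_iff_tendsto_charFun.2 fun t => ?_
    simp only [ProbabilityMeasure.coe_mk, Measure.map_id, charFun_gaussianReal,
      (hX _).charFun_rayleigh]
    have hinv : Tendsto (fun n : ℕ => (1 : ℝ) / n) atTop (𝓝 0) := tendsto_one_div_atTop_nhds_zero_nat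
    have hmain : Tendsto (fun n : ℕ => ((Real.exp (-(t ^ 2 / 2 * (1 - 1 / n))) : ℝ) : ℂ)) atTop
        (𝓝 (Real.exp (-(t ^ 2 / 2 * (1 - 0))) : ℝ)) :=
      (Complex.continuous_ofReal.tendsto _).comp ((Real.continuous_exp.tendsto _).comp
        ((tendsto_const_nhds.mul (tendsto_const_nhds.sub hinv)).neg))
    have herr : Tendsto (fun n : ℕ => 2 * t ^ 2 / √(p n) + 253 * t ^ 4 / n +
        12 * t ^ 4 * ((p n : ℝ) / n ^ 2)) atTop (𝓝 0) := by
      have h1 : Tendsto (fun n : ℕ => 2 * t ^ 2 / √(p n)) atTop (𝓝 0) :=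
        tendsto_const_nhds.div_atTop
          (Real.tendsto_sqrt_atTop.comp (tendsto_natCast_atTop_atTop.comp hp))
      have h2 : Tendsto (fun n : ℕ => 253 * t ^ 4 / (n : ℝ)) atTop (𝓝 0) :=
        tendsto_const_nhds.div_atTop tendsto_natCast_atTop_atTop
      simpa using (h1.add h2).add (hpn.const_mul (12 * t ^ 4))
    have hdiff := squeeze_zero_norm' (f := fun n : ℕ =>
        ∫ z, Complex.exp ((t * (√(2 * p n) / n * z.1) : ℝ) * Complex.I) ∂walkLaw (ν n) n -
          ((Real.exp (-(t ^ 2 / 2 * (1 - 1 / n))) : ℝ) : ℂ)) (by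
      filter_upwards [hν, eventually_ge_atTop 1, hp.eventually_ge_atTop 2] with n h hn hpn
      exact h.norm_integral_exp_walkLaw_sub_le hpn hn t) herr
    have := hdiff.add hmain
    simp only [sub_add_cancel, zero_add] at this
    convert this using 2
    push_cast
    congr 1
    simp

/-! ### Invariance of the uniform and the α-spherical laws -/

open scoped Pointwise in
/-- Surface measure on the sphere is invariant under linear isometries. -/
lemma toSphere_map_val_map_linearIsometryEquiv {E : Type*} [NormedAddCommGroup E]
    [InnerProductSpace ℝ E] [FiniteDimensional ℝ E] [MeasurableSpace E] [BorelSpace E]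
    (e : E ≃ₗᵢ[ℝ] E) :
    (((volume : Measure E).toSphere).map Subtype.val).map e =
      ((volume : Measure E).toSphere).map Subtype.val := by
  ext B hB
  rw [Measure.map_apply e.continuous.measurable hB,
    Measure.map_apply measurable_subtype_coe (e.continuous.measurable hB),
    Measure.map_apply measurable_subtype_coe hB,
    Measure.toSphere_apply' _ (measurable_subtype_coe (e.continuous.measurable hB)),
    Measure.toSphere_apply' _ (measurable_subtype_coe hB)]
  congr 1
  -- Surface measure is the dimension times the volume of the cone (0,1)·B; a linear isometry
  -- preserves volume and maps cones to cones.
  rw [← MeasurePreserving.measure_preimage_equiv (f := e.symm.toHomeomorph.toMeasurableEquiv)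
    e.symm.measurePreserving]
  congr 1
  ext x
  simp only [Set.mem_smul, Set.mem_image, Set.mem_preimage, Subtype.exists, exists_and_left,
    exists_prop, exists_eq_right_right]
  constructor
  · rintro ⟨r, hr, y, ⟨hyB, hy⟩, hxy⟩
    refine ⟨r, hr, e y, ⟨hyB, by simpa using hy⟩, ?_⟩
    rw [← map_smul, hxy]
    exact e.apply_symm_apply x
  · rintro ⟨r, hr, y, ⟨hyB, hy⟩, rfl⟩
    exact ⟨r, hr, e.symm y, ⟨by simpa using hyB, by simpa using hy⟩, (map_smul e.symm r y).symm⟩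

/-- `flipCoord k` as a linear isometry. -/
noncomputable def flipCoordIsometry {p : ℕ} (k : Fin p) :
    EuclideanSpace ℝ (Fin p) ≃ₗᵢ[ℝ] EuclideanSpace ℝ (Fin p) where
  toFun := flipCoord k
  invFun := flipCoord k
  map_add' x y := by ext i; by_cases h : i = k <;> simp [h, add_comm]
  map_smul' c x := by ext i; by_cases h : i = k <;> simp [h]
  left_inv x := by ext i; by_cases h : i = k <;> simp [h]
  right_inv x := by ext i; by_cases h : i = k <;> simp [h]
  norm_map' x := by
    simp only [LinearEquiv.coe_mk, LinearMap.coe_mk, AddHom.coe_mk, EuclideanSpace.norm_eq]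
    congr 1
    refine Finset.sum_congr rfl fun i _ => ?_
    by_cases h : i = k <;> simp [h]

lemma isSignPermInvariant_uniformSphere {p : ℕ} (hp : 1 ≤ p) :
    IsSignPermInvariant (uniformSphere p) := by
  have : Nonempty (Fin p) := ⟨⟨0, hp⟩⟩
  have hinv : ∀ e : EuclideanSpace ℝ (Fin p) ≃ₗᵢ[ℝ] EuclideanSpace ℝ (Fin p),
      (uniformSphere p).map e = uniformSphere p := by
    intro e
    simp only [uniformSphere, ProbabilityTheory.cond, Measure.restrict_univ, Measure.map_smul,
      toSphere_map_val_map_linearIsometryEquiv]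
  refine ⟨?_, ?_, fun k => hinv (flipCoordIsometry k), fun σ => ?_⟩
  · have := cond_isProbabilityMeasure (μ := (volume : Measure (EuclideanSpace ℝ (Fin p))).toSphere)
      (s := Set.univ) (by
        rw [Ne, Measure.measure_univ_eq_zero]
        exact Measure.toSphere_ne_zero _)
    exact Measure.isProbabilityMeasure_map (by fun_prop)
  · rw [uniformSphere, Measure.map_apply measurable_subtype_coe
      Metric.isClosed_sphere.measurableSet.compl]
    simp
  · exact hinv (LinearIsometryEquiv.piLpCongrLeft 2 ℝ ℝ σ.symm)

lemma measurable_sphereProj {p : ℕ} : Measurable (sphereProj (p := p)) := by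
  unfold sphereProj
  refine (PiLp.continuous_toLp 2 _).measurable.comp ?_
  fun_prop

/-- Signed permutations preserve the product law and the sum of squares, hence commute with
`sphereProj`. -/
lemma IsSymmAlphaSpherical.isSignPermInvariant {α : ℝ} {p : ℕ}
    {ν : Measure (EuclideanSpace ℝ (Fin p))} (h : IsSymmAlphaSpherical α p ν) :
    IsSignPermInvariant ν := by
  obtain ⟨hs, μ, hμ, -, hsymm, rfl⟩ := h
  refine ⟨Measure.isProbabilityMeasure_map measurable_sphereProj.aemeasurable, hs,
    fun k => ?_, fun σ => ?_⟩
  · have hmp : MeasurePreserving (fun (x : Fin p → ℝ) i => (if i = k then Neg.neg else id) (x i))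
        (Measure.pi fun _ => μ) (Measure.pi fun _ => μ) := by
      refine measurePreserving_pi _ _ fun i => ?_
      by_cases h : i = k
      · simp only [h, if_true]; exact ⟨measurable_neg, hsymm⟩
      · simp only [h, if_false]; exact MeasurePreserving.id _
    rw [Measure.map_map (continuous_flipCoord k).measurable measurable_sphereProj]
    conv_rhs => rw [← hmp.map_eq, Measure.map_map measurable_sphereProj hmp.measurable]
    congr 1
    ext x i
    have hnorm : ∀ j, (if j = k then Neg.neg else id) (x j) ^ 2 = x j ^ 2 := fun j => by
      by_cases h : j = k <;> simp [h]
    simp only [Function.comp_apply, flipCoord_apply, sphereProj, hnorm]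
    by_cases h : i = k <;> simp [h, neg_div]
  · have hmp : MeasurePreserving (fun (x : Fin p → ℝ) i => x (σ i))
        (Measure.pi fun _ => μ) (Measure.pi fun _ => μ) := by
      have := measurePreserving_piCongrLeft (fun _ : Fin p => μ) σ.symm
      convert this using 1
      ext x i
      obtain ⟨j, rfl⟩ := σ.symm.surjective i
      rw [MeasurableEquiv.coe_piCongrLeft, Equiv.piCongrLeft_apply_apply, σ.apply_symm_apply]
    rw [Measure.map_map (continuous_permCoord σ).measurable measurable_sphereProj]
    conv_rhs => rw [← hmp.map_eq, Measure.map_map measurable_sphereProj hmp.measurable]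
    congr 1
    ext x i
    simp only [Function.comp_apply, permCoord_apply, sphereProj]
    rw [Equiv.sum_comp σ fun j => x j ^ 2]

/-! ### Transfer of rejection probabilities -/

lemma MeasureTheory.TendstoInDistribution.tendsto_measureReal_le {γ : Measure ℝ} [IsProbabilityMeasure γ]
    {Ω : ℕ → Type*} [∀ n, MeasurableSpace (Ω n)]
    {P : (n : ℕ) → Measure (Ω n)} [∀ n, IsProbabilityMeasure (P n)] {Y : (n : ℕ) → Ω n → ℝ}
    (h : TendstoInDistribution Y atTop id P γ) {a : ℝ} (ha : γ {a} = 0) :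
    Tendsto (fun n => (P n).real {ω | a ≤ Y n ω}) atTop (𝓝 (γ.real (Set.Ici a))) := by
  have h1 := ProbabilityMeasure.tendsto_measure_of_null_frontier_of_tendsto' h.tendsto
    (E := Set.Ici a) (by simpa [frontier_Ici] using ha)
  simp only [ProbabilityMeasure.coe_mk, Measure.map_id] at h1
  refine ((ENNReal.tendsto_toReal (measure_ne_top _ _)).comp h1).congr fun n => ?_
  simp only [Function.comp_apply, Measure.real]
  rw [Measure.map_apply_of_aemeasurable (h.forall_aemeasurable n) measurableSet_Ici]
  rfl

/-- If two sequences of random variables converge in distribution to the same law without atoms,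
then tests based on them with the same critical values have the same asymptotic rejection
probability. -/
lemma tendsto_measureReal_le_of_tendstoInDistribution {γ : Measure ℝ} [IsProbabilityMeasure γ]
    (hγ : ∀ x, γ {x} = 0)
    {Ω Ω' : ℕ → Type*} [∀ n, MeasurableSpace (Ω n)] [∀ n, MeasurableSpace (Ω' n)]
    {P : (n : ℕ) → Measure (Ω n)} [∀ n, IsProbabilityMeasure (P n)]
    {P' : (n : ℕ) → Measure (Ω' n)} [∀ n, IsProbabilityMeasure (P' n)]
    {Y : (n : ℕ) → Ω n → ℝ} {Y' : (n : ℕ) → Ω' n → ℝ}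
    (hY : TendstoInDistribution Y atTop id P γ) (hY' : TendstoInDistribution Y' atTop id P' γ)
    {β : ℝ} (hβ0 : 0 < β) (hβ1 : β < 1) {c : ℕ → ℝ}
    (hc : Tendsto (fun n => (P' n).real {ω | c n ≤ Y' n ω}) atTop (𝓝 β)) :
    Tendsto (fun n => (P n).real {ω | c n ≤ Y n ω}) atTop (𝓝 β) := by
  have hG : ∀ x, γ.real (Set.Ici x) = 1 - cdf γ x := fun x => by
    rw [cdf_eq_real, ← Set.compl_Iio, probReal_compl_eq_one_sub measurableSet_Iio]
    congr 1
    exact measureReal_congr (Iio_ae_eq_Iic' (hγ x))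
  have hcont : Continuous (cdf γ) := by
    refine continuous_iff_continuousAt.2 fun x => ?_
    rw [(cdf γ).mono.continuousAt_iff_leftLim_eq_rightLim, (cdf γ).rightLim_eq]
    have := (cdf γ).measure_singleton x
    rw [measure_cdf, hγ, eq_comm, ENNReal.ofReal_eq_zero] at this
    exact le_antisymm ((cdf γ).mono.leftLim_le le_rfl) (by linarith)
  have hsurj : ∀ y, 0 < y → y < 1 → ∃ a, γ.real (Set.Ici a) = y := by
    intro y hy0 hy1
    obtain ⟨a, ha⟩ := mem_range_of_exists_le_of_exists_ge hcont (c := 1 - y)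
      ((tendsto_cdf_atBot γ).eventually_le_const (by linarith)).exists
      ((tendsto_cdf_atTop γ).eventually_const_le (by linarith)).exists
    exact ⟨a, by rw [hG, ha]; ring⟩
  have hle : ∀ {y}, β < y → ∀ᶠ n in atTop, (P n).real {ω | c n ≤ Y n ω} < y := by
    intro y hy
    -- `c` need not converge. If a is the upper `y'`-quantile with `y'` > β, then c_n < a would
    -- force a rejection probability under `P'` near `y'` or above; so eventually a ≤ c_n.
    obtain ⟨y', hy1, hy2⟩ := exists_between (lt_min hy hβ1)
    obtain ⟨a, ha⟩ := hsurj y' (by linarith) (hy2.trans_le (min_le_right _ _))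
    have h1 := hY'.tendsto_measureReal_le (hγ a)
    have h2 := hY.tendsto_measureReal_le (hγ a)
    rw [ha] at h1 h2
    filter_upwards [hc.eventually_lt h1 hy1,
      h2.eventually_lt_const (hy2.trans_le (min_le_left _ _))] with n hn1 hn2
    have hac : a ≤ c n := by
      by_contra! hca
      exact hn1.not_ge (measureReal_mono fun ω hω => hca.le.trans hω)
    exact (measureReal_mono fun ω hω => hac.trans hω).trans_lt hn2
  have hge : ∀ {y}, y < β → ∀ᶠ n in atTop, y < (P n).real {ω | c n ≤ Y n ω} := by
    intro y hy
    obtain ⟨y', hy1, hy2⟩ := exists_between (max_lt hy hβ0)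
    obtain ⟨a, ha⟩ := hsurj y' ((le_max_right _ _).trans_lt hy1) (by linarith)
    have h1 := hY'.tendsto_measureReal_le (hγ a)
    have h2 := hY.tendsto_measureReal_le (hγ a)
    rw [ha] at h1 h2
    filter_upwards [h1.eventually_lt hc hy2,
      h2.eventually_const_lt ((le_max_left _ _).trans_lt hy1)] with n hn1 hn2
    have hac : c n ≤ a := by
      by_contra! hca
      exact hn1.not_ge (measureReal_mono fun ω hω => hca.le.trans hω)
    exact hn2.trans_le (measureReal_mono fun ω hω => hac.trans hω)
  exact tendsto_order.2 ⟨fun y hy => hge hy, fun y hy => hle hy⟩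

theorem theorem1 (α : ℝ) (hα0 : 0 < α) (hα2 : α < 2)
    (p : ℕ → ℕ) (hp : Tendsto p atTop atTop)
    (hpn : Tendsto (fun n : ℕ => (p n : ℝ) / (n : ℝ) ^ 2) atTop (𝓝 0))
    (ν : (n : ℕ) → Measure (EuclideanSpace ℝ (Fin (p n))))
    (hν : ∀ n, IsSymmAlphaSpherical α (p n) (ν n))
    {Ω : ℕ → Type*} [∀ n, MeasurableSpace (Ω n)]
    (P : (n : ℕ) → Measure (Ω n)) [∀ n, IsProbabilityMeasure (P n)]
    (X : (n : ℕ) → Fin n → Ω n → EuclideanSpace ℝ (Fin (p n)))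
    (hX : ∀ n, IsIIDSample (P n) (X n) (ν n))
    {Ω₀ : ℕ → Type*} [∀ n, MeasurableSpace (Ω₀ n)]
    (P₀ : (n : ℕ) → Measure (Ω₀ n)) [∀ n, IsProbabilityMeasure (P₀ n)]
    (U : (n : ℕ) → Fin n → Ω₀ n → EuclideanSpace ℝ (Fin (p n)))
    (hU : ∀ n, IsIIDSample (P₀ n) (U n) (uniformSphere (p n))) :
    -- convergence in distribution to N(0,1) under the alternatives
    TendstoInDistribution (fun n ω => rayleigh (fun i => X n i ω)) atTop (id : ℝ → ℝ) P
      (gaussianReal 0 1) ∧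
    -- the same limit under uniformity
    TendstoInDistribution (fun n ω => rayleigh (fun i => U n i ω)) atTop (id : ℝ → ℝ) P₀
      (gaussianReal 0 1) ∧
    -- a Rayleigh test of asymptotic size β has asymptotic power β
    ∀ β : ℝ, 0 < β → β < 1 → ∀ c : ℕ → ℝ,
      Tendsto (fun n => (P₀ n).real {ω | c n ≤ rayleigh (fun i => U n i ω)}) atTop (𝓝 β) →
      Tendsto (fun n => (P n).real {ω | c n ≤ rayleigh (fun i => X n i ω)}) atTop (𝓝 β) := by
  have hνinv : ∀ n, IsSignPermInvariant (ν n) := fun n => (hν n).isSignPermInvariant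
  have h1 := tendstoInDistribution_rayleigh p hp hpn ν (.of_forall hνinv) P X hX
  -- In dimension 0 the sphere is empty and `uniformSphere` is the zero measure, so invariance is
  -- only claimed eventually.
  have h2 := tendstoInDistribution_rayleigh p hp hpn (fun n => uniformSphere (p n))
    ((hp.eventually_ge_atTop 1).mono fun n hn => isSignPermInvariant_uniformSphere hn) P₀ U hU
  have hatom : ∀ x, gaussianReal 0 1 {x} = 0 := fun x =>
    (nullSingletonClass_gaussianReal one_ne_zero).measure_singleton x
  exact ⟨h1, h2, fun β hβ0 hβ1 c hc =>
    tendsto_measureReal_le_of_tendstoInDistribution hatom h1 h2 hβ0 hβ1 hc⟩
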